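/- \textbf{Setting.} Let $n\ge 1$ and let $G=(N,E)$ be a directed tree on the buses $N=\{0,1,\dots,n\}$, rooted at $0$ with edges pointing away from the root; $\pi(j)$ is the parent of $j\neq 0$, and each line is $(\pi(j),j)$. Each line $(i,j)$ has resistance $r_{ij}\ge 0$ and reactance $x_{ij}\ge 0$. The variables are the sending-end powers $p_{ij},q_{ij}$ and squared current magnitudes $\ell_{ij}\ge 0$ of the lines (stacked in $\overline p,\overline q,\ell\in\mathbb R^n$), and the squared voltage magnitudes $v_i\ge 0$ and net power demands $p_i,q_i$ of the buses. Let $A^i,A^o\in\{0,1\}^{(n+1)\times n}$ be the matrices with $A^i_{k,(i,j)}=1$ iff $k=j$ and $A^o_{k,(i,j)}=1$ iff $k=i$; put $A=A^o-A^i$, and let $A_2,A^o_2$ be $A,A^o$ with the row of bus $0$ removed. $[y]$ denotes the diagonal matrix with diagonal $y$. The relaxed branch flow equations are $$p=A^i(\overline p-[r]\ell)-A^o\overline p,\qquad q=A^i(\overline q-[x]\ell)-A^o\overline q,$$ $$A^{iT}v=A^{oT}v-2([r]\overline p+[x]\overline q)+([r]^2+[x]^2)\ell,\qquad [A^{oT}v]\ell=[\overline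 p]\overline p+[\overline q]\overline q,$$ written as $\varphi(u,\xi)=0$ with variables $u=(\overline p,\overline q,\ell,v_{1\dots n},p_0,q_0)\in\mathbb R^{4n+2}$ and parameters $\xi=(v_0,p_{1\dots n},q_{1\dots n})\in\mathbb R^{2n+1}$; bus $0$ is a slack bus, $v_0=1$. Let $\varphi_u=\partial\varphi/\partial u$, and define the reduced power flow Jacobian $$\varphi_u'=[A^{oT}v]+2[\overline p]A_2^{-1}[r]+2[\overline q]A_2^{-1}[x]-[\ell]A_2^{oT}(A_2^T)^{-1}\big([r]^2+2[r]A_2^{-1}[r]+[x]^2+2[x]A_2^{-1}[x]\big)\in\mathbb R^{n\times n}.$$ An \emph{operating point} is a solution $(u,\xi)$ with $v_0=1$, all $v_i,\ell_{ij}\ge0$, and $p_j,q_j\ge 0$ for $j=1,\dots,n$. The \emph{flat voltage solution} is the operating point with $v=\mathbf 1$ and all other quantities $0$. The \emph{voltage stability region} is the connected component containing the flat voltage solution of the set of operating points at which $\det\varphi_u\neq0$. For a square matrix $M$, let $M_{\rm diag}$ and $M_{\rm off}$ be its diagonal and off-diagonal parts and $\rho(M)$ its spectral radius. Put $$\mathrm{VSI}=\frac{\ln\det\varphi_u'}{n},\qquad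 \mathrm{VSIA}=\frac1n\ln\prod_{j=1}^n\varphi'_{u,jj},\qquad \rho=\rho\big((\varphi'_{u,\rm diag})^{-1}\varphi'_{u,\rm off}\big).$$ \textbf{Theorem.} At every point of the voltage stability region at which all demands $p_j,q_j$ $(j=1,\dots,n)$ are positive, one has $\det\varphi_u'>0$, $\varphi'_{u,jj}>0$ for all $j$, and $\rho<1$ (so that the quantities above are well defined), and $$\mathrm{VSI}\;\le\;\mathrm{VSIA}\;\le\;\mathrm{VSI}-\rho\,\ln(1-\rho).$$ -/

import Mathlib

open scoped Matrix

noncomputable section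

namespace RadialGrid

/-- A radial distribution network with root `0` (the substation) and `n` further buses
`1, …, n`.  The buses are `Fin (n + 1)`.  Every bus other than the root has a unique parent,
and every bus is reached from the root along parent-to-child edges, so that the edges
`(parent e, e.succ)` form a directed tree rooted at `0`.  An edge is indexed by its child:
`e : Fin n` is the line from `parent e` to the bus `e.succ`.
`r e` and `x e` are the resistance and the reactance of that line. -/
structure Network (n : ℕ) where
  parent : Fin n → Fin (n + 1)
  rooted : ∀ j : Fin (n + 1),
    Relation.ReflTransGen (fun a b => ∃ e : Fin n, a = parent e ∧ b = e.succ) 0 j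
  r : Fin n → ℝ
  x : Fin n → ℝ
  r_nonneg : ∀ e, 0 ≤ r e
  x_nonneg : ∀ e, 0 ≤ x e

/-- Index set of the unknowns: line active powers, line reactive powers, squared line
currents, squared voltages at the buses `1, …, n`, and the two powers at the root. -/
abbrev VarIdx (n : ℕ) := Fin n ⊕ Fin n ⊕ Fin n ⊕ Fin n ⊕ Fin 1 ⊕ Fin 1

/-- Index set of the parameters: squared voltage at the root, active demands and reactive
demands at the buses `1, …, n`. -/
abbrev ParIdx (n : ℕ) := Fin 1 ⊕ Fin n ⊕ Fin n

/-- Index set of the equations: active balance and reactive balance at every bus, voltage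
drop and current equation on every line. -/
abbrev EqIdx (n : ℕ) := Fin (n + 1) ⊕ Fin (n + 1) ⊕ Fin n ⊕ Fin n

/-- The vector of the system variables. -/
abbrev Vars (n : ℕ) := VarIdx n → ℝ

/-- The vector of the system parameters. -/
abbrev Params (n : ℕ) := ParIdx n → ℝ

section Coordinates

variable {n : ℕ}

/-- Sending-end active power on each line. -/
def pLine (u : Vars n) : Fin n → ℝ := fun e => u (.inl e)

/-- Sending-end reactive power on each line. -/
def qLine (u : Vars n) : Fin n → ℝ := fun e => u (.inr (.inl e))

/-- Squared current magnitude on each line. -/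
def cur (u : Vars n) : Fin n → ℝ := fun e => u (.inr (.inr (.inl e)))

/-- Squared voltage magnitude at each bus. -/
def volt (u : Vars n) (ξ : Params n) : Fin (n + 1) → ℝ :=
  Fin.cons (ξ (.inl 0)) (fun e => u (.inr (.inr (.inr (.inl e)))))

/-- Net active power demand at each bus. -/
def pBus (u : Vars n) (ξ : Params n) : Fin (n + 1) → ℝ :=
  Fin.cons (u (.inr (.inr (.inr (.inr (.inl 0)))))) (fun e => ξ (.inr (.inl e)))

/-- Net reactive power demand at each bus. -/
def qBus (u : Vars n) (ξ : Params n) : Fin (n + 1) → ℝ :=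
  Fin.cons (u (.inr (.inr (.inr (.inr (.inr 0)))))) (fun e => ξ (.inr (.inr e)))

end Coordinates

namespace Network

variable {n : ℕ} (G : Network n)

/-- The matrix selecting, for each bus, the line that enters it. -/
def Ain (_G : Network n) : Matrix (Fin (n + 1)) (Fin n) ℝ :=
  Matrix.of fun j e => if j = e.succ then 1 else 0

/-- The matrix selecting, for each bus, the lines that leave it. -/
def Aout : Matrix (Fin (n + 1)) (Fin n) ℝ :=
  Matrix.of fun i e => if i = G.parent e then 1 else 0

/-- The incidence matrix. -/
def A : Matrix (Fin (n + 1)) (Fin n) ℝ := G.Aout - G.Ain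

/-- `Aout` without the row of the root. -/
def Aout₂ : Matrix (Fin n) (Fin n) ℝ := G.Aout.submatrix Fin.succ id

/-- The incidence matrix without the row of the root. -/
def A₂ : Matrix (Fin n) (Fin n) ℝ := G.A.submatrix Fin.succ id

/-- The residual of the relaxed branch flow equations. -/
def phi (u : Vars n) (ξ : Params n) : EqIdx n → ℝ :=
  Sum.elim
    (G.Ain *ᵥ (pLine u - G.r * cur u) - G.Aout *ᵥ pLine u - pBus u ξ) <|
  Sum.elim
    (G.Ain *ᵥ (qLine u - G.x * cur u) - G.Aout *ᵥ qLine u - qBus u ξ) <|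
  Sum.elim
    (G.Aoutᵀ *ᵥ volt u ξ - (2 : ℝ) • (G.r * pLine u + G.x * qLine u)
      + (G.r ^ 2 + G.x ^ 2) * cur u - G.Ainᵀ *ᵥ volt u ξ)
    (pLine u * pLine u + qLine u * qLine u - (G.Aoutᵀ *ᵥ volt u ξ) * cur u)

/-- The Jacobian of `phi` with respect to the system variables, by blocks of rows and columns
(see `hasFDerivAt_phi`). -/
def jacBlocks (u : Vars n) (ξ : Params n) : Matrix (EqIdx n) (VarIdx n) ℝ :=
  Matrix.fromRows
    (Matrix.fromCols (-G.A) <| Matrix.fromCols 0 <|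
      Matrix.fromCols (-(G.Ain * Matrix.diagonal G.r)) <| Matrix.fromCols 0 <|
      Matrix.fromCols (Matrix.of fun j _ => if j = 0 then -1 else 0) 0) <|
  Matrix.fromRows
    (Matrix.fromCols 0 <| Matrix.fromCols (-G.A) <|
      Matrix.fromCols (-(G.Ain * Matrix.diagonal G.x)) <| Matrix.fromCols 0 <|
      Matrix.fromCols 0 (Matrix.of fun j _ => if j = 0 then -1 else 0)) <|
  Matrix.fromRows
    (Matrix.fromCols (-((2 : ℝ) • Matrix.diagonal G.r)) <|
      Matrix.fromCols (-((2 : ℝ) • Matrix.diagonal G.x)) <|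
      Matrix.fromCols (Matrix.diagonal G.r ^ 2 + Matrix.diagonal G.x ^ 2) <|
      Matrix.fromCols G.A₂ᵀ <| Matrix.fromCols 0 0)
    (Matrix.fromCols ((2 : ℝ) • Matrix.diagonal (pLine u)) <|
      Matrix.fromCols ((2 : ℝ) • Matrix.diagonal (qLine u)) <|
      Matrix.fromCols (-Matrix.diagonal (G.Aoutᵀ *ᵥ volt u ξ)) <|
      Matrix.fromCols (-(Matrix.diagonal (cur u) * G.Aout₂ᵀ)) <| Matrix.fromCols 0 0)

theorem volt_line (u h : Vars n) (ξ : Params n) (t : ℝ) :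
    volt (u + t • h) ξ = volt u ξ + t • volt h 0 := by
  ext i
  refine Fin.cases ?_ (fun e => ?_) i <;> simp [volt]

theorem jacBlocks_mulVec (u h : Vars n) (ξ : Params n) :
    G.jacBlocks u ξ *ᵥ h =
      Sum.elim (G.Ain *ᵥ (pLine h - G.r * cur h) - G.Aout *ᵥ pLine h - pBus h 0) (
      Sum.elim (G.Ain *ᵥ (qLine h - G.x * cur h) - G.Aout *ᵥ qLine h - qBus h 0) (
      Sum.elim
        (G.Aoutᵀ *ᵥ volt h 0 - (2 : ℝ) • (G.r * pLine h + G.x * qLine h)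
          + (G.r ^ 2 + G.x ^ 2) * cur h - G.Ainᵀ *ᵥ volt h 0)
        ((2 : ℝ) • (pLine u * pLine h + qLine u * qLine h)
          - (G.Aoutᵀ *ᵥ volt u ξ) * cur h - (G.Aoutᵀ *ᵥ volt h 0) * cur u))) := by
  have hh : h = Sum.elim (pLine h) (Sum.elim (qLine h) (Sum.elim (cur h)
      (Sum.elim (fun e => volt h 0 e.succ)
        (Sum.elim (fun _ => pBus h 0 0) (fun _ => qBus h 0 0))))) := by
    ext k
    rcases k with e | e | e | e | e | e <;> simp [pLine, qLine, cur, volt, pBus, qBus] <;>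
      rw [Subsingleton.elim e 0]
  have hd : ∀ a b : Fin n → ℝ, Matrix.diagonal a *ᵥ b = a * b := fun a b => by
    ext i; simp [Matrix.mulVec_diagonal]
  have h0 : volt h 0 0 = 0 := by simp [volt]
  have hb : ∀ B : Matrix (Fin (n + 1)) (Fin n) ℝ,
      Bᵀ *ᵥ volt h 0 = (B.submatrix Fin.succ id)ᵀ *ᵥ fun e => volt h 0 e.succ := by
    intro B; ext e
    simp [Matrix.mulVec, dotProduct, Fin.sum_univ_succ, h0]
  have hs : ((G.Aout - G.Ain).submatrix Fin.succ id)ᵀ =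
      (G.Aout.submatrix Fin.succ id)ᵀ - (G.Ain.submatrix Fin.succ id)ᵀ := rfl
  conv_lhs => rw [hh]
  simp only [jacBlocks, Matrix.fromRows_mulVec, Matrix.fromCols_mulVec_sumElim, Matrix.zero_mulVec,
    Matrix.neg_mulVec, Matrix.smul_mulVec, Matrix.add_mulVec, ← Matrix.mulVec_mulVec, hd, pow_two,
    A₂, A, Aout₂, hb, Matrix.sub_mulVec, Matrix.mulVec_sub, hs]
  congr 1
  · ext j
    refine Fin.cases ?_ (fun e => ?_) j <;>
      simp [Matrix.mulVec, dotProduct, pBus] <;> ring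
  congr 1
  · ext j
    refine Fin.cases ?_ (fun e => ?_) j <;>
      simp [Matrix.mulVec, dotProduct, qBus] <;> ring
  congr 1
  · ext j
    simp
    ring
  · ext j
    simp
    ring

theorem hasFDerivAt_phi (u : Vars n) (ξ : Params n) :
    HasFDerivAt (fun u' => G.phi u' ξ)
      (Matrix.mulVecLin (G.jacBlocks u ξ)).toContinuousLinearMap u := by
  have hdiff : DifferentiableAt ℝ (fun u' => G.phi u' ξ) u := by
    have hv : ∀ j, DifferentiableAt ℝ (fun u' => volt u' ξ j) u := fun j => by
      refine Fin.cases ?_ (fun e => ?_) j <;> simp [volt] <;> fun_prop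
    have hp : ∀ j, DifferentiableAt ℝ (fun u' => pBus u' ξ j) u := fun j => by
      refine Fin.cases ?_ (fun e => ?_) j <;> simp [pBus] <;> fun_prop
    have hq : ∀ j, DifferentiableAt ℝ (fun u' => qBus u' ξ j) u := fun j => by
      refine Fin.cases ?_ (fun e => ?_) j <;> simp [qBus] <;> fun_prop
    rw [differentiableAt_pi]
    rintro (j | j | j | j) <;>
      simp only [phi, Sum.elim_inl, Sum.elim_inr, Matrix.mulVec, dotProduct, Pi.sub_apply,
        Pi.add_apply, Pi.mul_apply, Pi.smul_apply, pLine, qLine, cur] <;> fun_prop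
  have hline : ∀ h, HasDerivAt (fun t : ℝ => G.phi (u + t • h) ξ) (G.jacBlocks u ξ *ᵥ h) 0 := by
    intro h
    have hpb : ∀ t : ℝ, pBus (u + t • h) ξ = pBus u ξ + t • pBus h 0 := fun t => by
      ext i
      refine Fin.cases ?_ (fun e => ?_) i <;> simp [pBus]
    have hqb : ∀ t : ℝ, qBus (u + t • h) ξ = qBus u ξ + t • qBus h 0 := fun t => by
      ext i
      refine Fin.cases ?_ (fun e => ?_) i <;> simp [qBus]
    have key : ∀ t : ℝ, G.phi (u + t • h) ξ = G.phi u ξ + t • (G.jacBlocks u ξ *ᵥ h)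
        + t ^ 2 • (Sum.elim 0 (Sum.elim 0 (Sum.elim 0 (pLine h * pLine h + qLine h * qLine h
          - (G.Aoutᵀ *ᵥ volt h 0) * cur h))) : EqIdx n → ℝ) := by
      intro t
      have h1 : pLine (u + t • h) = pLine u + t • pLine h := rfl
      have h2 : qLine (u + t • h) = qLine u + t • qLine h := rfl
      have h3 : cur (u + t • h) = cur u + t • cur h := rfl
      have h4 : G.r * (cur u + t • cur h) = G.r * cur u + t • (G.r * cur h) := by
        ext i; simp; ring
      have h5 : G.x * (cur u + t • cur h) = G.x * cur u + t • (G.x * cur h) := by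
        ext i; simp; ring
      rw [jacBlocks_mulVec]
      ext k
      rcases k with j | j | j | j <;>
        simp [phi, volt_line, hpb, hqb, h1, h2, h3, h4, h5, Matrix.mulVec_add, Matrix.mulVec_sub,
          Matrix.mulVec_smul] <;> ring
    simp only [key]
    have := (((hasDerivAt_id (0 : ℝ)).smul_const (G.jacBlocks u ξ *ᵥ h)).const_add
      (G.phi u ξ)).add (((hasDerivAt_id (0 : ℝ)).pow 2).smul_const
      (Sum.elim 0 (Sum.elim 0 (Sum.elim 0 (pLine h * pLine h + qLine h * qLine h
          - (G.Aoutᵀ *ᵥ volt h 0) * cur h))) : EqIdx n → ℝ))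
    refine HasDerivAt.congr_deriv this ?_
    simp
  have : fderiv ℝ (fun u' => G.phi u' ξ) u =
      (Matrix.mulVecLin (G.jacBlocks u ξ)).toContinuousLinearMap := by
    refine ContinuousLinearMap.ext fun h => ?_
    have hl : HasLineDerivAt ℝ (fun u' => G.phi u' ξ) (G.jacBlocks u ξ *ᵥ h) u h := hline h
    have := hl.lineDeriv
    rw [hdiff.lineDeriv_eq_fderiv] at this
    simpa using this
  rw [← this]
  exact hdiff.hasFDerivAt

end Network

/-- The equations, numbered block after block. -/
def eqOrder (n : ℕ) : EqIdx n ≃ Fin (4 * n + 2) :=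
  ((Equiv.sumCongr (Equiv.refl _)
      ((Equiv.sumCongr (Equiv.refl _) finSumFinEquiv).trans finSumFinEquiv)).trans
    finSumFinEquiv).trans (finCongr (by ring))

/-- The variables, numbered block after block. -/
def varOrder (n : ℕ) : VarIdx n ≃ Fin (4 * n + 2) :=
  ((Equiv.sumCongr (Equiv.refl _)
      ((Equiv.sumCongr (Equiv.refl _)
        ((Equiv.sumCongr (Equiv.refl _)
          ((Equiv.sumCongr (Equiv.refl _) finSumFinEquiv).trans finSumFinEquiv)).trans
            finSumFinEquiv)).trans finSumFinEquiv)).trans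
    finSumFinEquiv).trans (finCongr (by ring))

namespace Network

variable {n : ℕ} (G : Network n)

/-- The power flow Jacobian, a square matrix of size `4 n + 2`. -/
def jac (u : Vars n) (ξ : Params n) : Matrix (Fin (4 * n + 2)) (Fin (4 * n + 2)) ℝ :=
  Matrix.reindex (eqOrder n) (varOrder n) (G.jacBlocks u ξ)

/-- The reduced power flow Jacobian. -/
def redJac (u : Vars n) (ξ : Params n) : Matrix (Fin n) (Fin n) ℝ :=
  Matrix.diagonal (G.Aoutᵀ *ᵥ volt u ξ)
    + (2 : ℝ) • (Matrix.diagonal (pLine u) * G.A₂⁻¹ * Matrix.diagonal G.r)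
    + (2 : ℝ) • (Matrix.diagonal (qLine u) * G.A₂⁻¹ * Matrix.diagonal G.x)
    - Matrix.diagonal (cur u) * G.Aout₂ᵀ * (G.A₂ᵀ)⁻¹ *
      (Matrix.diagonal G.r ^ 2 + (2 : ℝ) • (Matrix.diagonal G.r * G.A₂⁻¹ * Matrix.diagonal G.r)
        + Matrix.diagonal G.x ^ 2
        + (2 : ℝ) • (Matrix.diagonal G.x * G.A₂⁻¹ * Matrix.diagonal G.x))

/-- The operating points `(u, ξ)` of a network whose buses `1, …, n` are loads: solutions of
the relaxed branch flow equations with unit voltage at the root, nonnegative squared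
magnitudes, and no bus `1, …, n` with negative active or reactive demand.  (The demands are
allowed to vanish because they do so at the flat voltage solution.) -/
def operatingPoints : Set (Vars n × Params n) :=
  {w | G.phi w.1 w.2 = 0 ∧ volt w.1 w.2 0 = 1 ∧
    (∀ i, 0 ≤ volt w.1 w.2 i) ∧ (∀ e, 0 ≤ cur w.1 e) ∧
    (∀ e : Fin n, 0 ≤ pBus w.1 w.2 e.succ) ∧ (∀ e : Fin n, 0 ≤ qBus w.1 w.2 e.succ)}

end Network

/-- The flat voltage solution: unit voltage at every bus, everything else zero. -/
def flat (n : ℕ) : Vars n × Params n :=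
  (Sum.elim 0 <| Sum.elim 0 <| Sum.elim 0 <| Sum.elim 1 0, Sum.elim 1 0)

/-- The voltage stability region: the connected region around the flat voltage solution, in
the set of operating points, on which the power flow Jacobian is nonsingular. -/
def Network.stabilityRegion {n : ℕ} (G : Network n) : Set (Vars n × Params n) :=
  connectedComponentIn {w | w ∈ G.operatingPoints ∧ (G.jac w.1 w.2).det ≠ 0} (flat n)

section MatrixNotions

variable {n : ℕ}

/-- The diagonal part of a matrix. -/
def diagPart (M : Matrix (Fin n) (Fin n) ℝ) : Matrix (Fin n) (Fin n) ℝ :=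
  Matrix.diagonal M.diag

/-- The off-diagonal part of a matrix. -/
def offPart (M : Matrix (Fin n) (Fin n) ℝ) : Matrix (Fin n) (Fin n) ℝ :=
  M - diagPart M

/-- The spectral radius of a real matrix: the largest modulus of its complex eigenvalues. -/
def specRad (M : Matrix (Fin n) (Fin n) ℝ) : ℝ :=
  (spectralRadius ℂ (M.map (algebraMap ℝ ℂ))).toReal

end MatrixNotions

namespace Network

variable {n : ℕ} (G : Network n)

/-- The voltage stability index. -/
def VSI (u : Vars n) (ξ : Params n) : ℝ :=
  Real.log (G.redJac u ξ).det / n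

/-- The approximate voltage stability index. -/
def VSIA (u : Vars n) (ξ : Params n) : ℝ :=
  Real.log (∏ e, G.redJac u ξ e e) / n

/-- The spectral radius of the inverse diagonal part times the off-diagonal part of the reduced
power flow Jacobian. -/
def rho (u : Vars n) (ξ : Params n) : ℝ :=
  specRad ((diagPart (G.redJac u ξ))⁻¹ * offPart (G.redJac u ξ))

end Network

end RadialGrid

end

/-!
The reduced Jacobian is the identity at the flat voltage solution. At every operating point of a
radial network its off-diagonal entries are nonpositive, since the line flows are nonnegative and
the reduced incidence matrix has a nonpositive inverse. It is, up to sign, a Schur complement in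
the full Jacobian, hence nonsingular wherever the full Jacobian is. Nonsingular M-matrices are
relatively open and closed among the nonsingular matrices with nonpositive off-diagonal entries, so
by connectedness the reduced Jacobian is an M-matrix throughout the voltage stability region.

For an M-matrix `M` with diagonal part `D`, Hadamard's inequality `det M ≤ det D` is
`VSI ≤ VSIA`. Conversely, write `M = D (1 + C)`, where `C` has trace zero and spectral radius
`ρ < 1`. Every eigenvalue `z` of `C` satisfies `|1 + z| ≥ (1 - ρ) exp (ρ + Re z)`, and multiplying
over the eigenvalues gives `det (1 + C) ≥ ((1 - ρ) exp ρ) ^ n`. It remains to note that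
`log (1 - ρ) + ρ ≥ ρ log (1 - ρ)`.
-/

section MMatrix

variable {ι κ R : Type*} [Fintype ι] [Fintype κ] [Field R] [LinearOrder R]

/-- A monotone matrix in the sense of Collatz: multiplication by it reflects nonnegativity of
vectors. Equivalently, it is invertible with entrywise nonnegative inverse. -/
def IsInverseMonotone (M : Matrix ι ι R) : Prop :=
  ∀ y, 0 ≤ M *ᵥ y → 0 ≤ y

/-- A nonsingular M-matrix. Among the many equivalent characterizations, the one chosen here is
semipositivity: the off-diagonal entries are nonpositive and some positive vector is mapped to a
positive vector. -/
structure IsMMatrix (M : Matrix ι ι R) : Prop where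
  off_diag_nonpos : ∀ i j, i ≠ j → M i j ≤ 0
  semipositive : ∃ x : ι → R, (∀ i, 0 < x i) ∧ ∀ i, 0 < (M *ᵥ x) i

variable [IsStrictOrderedRing R] {M : Matrix ι ι R}

theorem IsMMatrix.isInverseMonotone (hM : IsMMatrix M) : IsInverseMonotone M := by
  obtain ⟨x, hx, hMx⟩ := hM.semipositive
  intro y hy
  by_contra hneg
  obtain ⟨k, hk⟩ : ∃ k, y k < 0 := by simpa [Pi.le_def] using hneg
  have : Nonempty ι := ⟨k⟩
  -- Compare `y` with the largest multiple `c • x` below it; they touch at the index `i`.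
  obtain ⟨i, hi⟩ := Finite.exists_min fun j => y j / x j
  set c := y i / x i
  have hc : c < 0 := (hi k).trans_lt (div_neg_of_neg_of_pos hk (hx k))
  have hcx : ∀ j, c * x j ≤ y j := fun j => (le_div_iff₀ (hx j)).mp (hi j)
  have hci : y i = c * x i := (div_mul_cancel₀ _ (hx i).ne').symm
  have hle : (M *ᵥ y) i ≤ c * (M *ᵥ x) i := by
    simp only [Matrix.mulVec, dotProduct, Finset.mul_sum]
    refine Finset.sum_le_sum fun j _ => ?_
    rw [mul_left_comm]
    by_cases hij : i = j
    · rw [← hij, hci]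
    · exact mul_le_mul_of_nonpos_left (hcx j) (hM.off_diag_nonpos i j hij)
  exact (hle.trans_lt (mul_neg_of_neg_of_pos hc (hMx i))).not_ge (hy i)

theorem IsMMatrix.submatrix (hM : IsMMatrix M) {f : κ → ι} (hf : f.Injective) :
    IsMMatrix (M.submatrix f f) := by
  classical
  obtain ⟨x, hx, hMx⟩ := hM.semipositive
  refine ⟨fun i j hij => hM.off_diag_nonpos _ _ (hf.ne hij), x ∘ f, fun i => hx _, fun i => ?_⟩
  have hcompl : ∑ j ∈ (Finset.univ.image f)ᶜ, M (f i) j * x j ≤ 0 := by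
    refine Finset.sum_nonpos fun j hj => mul_nonpos_of_nonpos_of_nonneg ?_ (hx j).le
    exact hM.off_diag_nonpos _ _ fun h => by simp [← h] at hj
  calc 0 < (M *ᵥ x) (f i) := hMx (f i)
    _ = ∑ j ∈ Finset.univ.image f, M (f i) j * x j
        + ∑ j ∈ (Finset.univ.image f)ᶜ, M (f i) j * x j := (Finset.sum_add_sum_compl _ _).symm
    _ ≤ ∑ j ∈ Finset.univ.image f, M (f i) j * x j := add_le_of_nonpos_right hcompl
    _ = (M.submatrix f f *ᵥ (x ∘ f)) i := Finset.sum_image hf.injOn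

theorem IsMMatrix.diag_pos (hM : IsMMatrix M) (i : ι) : 0 < M i i := by
  classical
  obtain ⟨x, hx, hMx⟩ := hM.semipositive
  have hi := hMx i
  rw [Matrix.mulVec, dotProduct, ← Finset.add_sum_erase _ _ (Finset.mem_univ i)] at hi
  have hoff : ∑ j ∈ Finset.univ.erase i, M i j * x j ≤ 0 :=
    Finset.sum_nonpos fun j hj => mul_nonpos_of_nonpos_of_nonneg
      (hM.off_diag_nonpos i j (Finset.ne_of_mem_erase hj).symm) (hx j).le
  exact pos_of_mul_pos_left (by linarith : 0 < M i i * x i) (hx i).le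

section Inverse

variable [DecidableEq ι]

theorem IsInverseMonotone.isUnit_det (hM : IsInverseMonotone M) : IsUnit M.det := by
  rw [isUnit_iff_ne_zero]
  intro hdet
  obtain ⟨v, hv, hMv⟩ := Matrix.exists_mulVec_eq_zero_iff.mpr hdet
  have hneg : 0 ≤ -v := hM (-v) (by rw [Matrix.mulVec_neg, hMv, neg_zero])
  exact hv (le_antisymm (neg_nonneg.mp hneg) (hM v hMv.ge))

theorem IsInverseMonotone.inv_nonneg (hM : IsInverseMonotone M) (i j : ι) : 0 ≤ M⁻¹ i j := by
  have hcol : M *ᵥ (M⁻¹ *ᵥ Pi.single j 1) = Pi.single j 1 := by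
    rw [Matrix.mulVec_mulVec, Matrix.mul_nonsing_inv _ hM.isUnit_det, Matrix.one_mulVec]
  simpa using hM (M⁻¹ *ᵥ Pi.single j 1) (by rw [hcol]; exact Pi.single_nonneg.mpr zero_le_one) i

theorem IsMMatrix.one : IsMMatrix (1 : Matrix ι ι R) :=
  ⟨fun _ _ hij => (Matrix.one_apply_ne hij).le, 1, fun _ => one_pos, fun _ => by simp⟩

theorem IsMMatrix.isUnit_det (hM : IsMMatrix M) : IsUnit M.det :=
  hM.isInverseMonotone.isUnit_det

theorem IsMMatrix.inv_nonneg (hM : IsMMatrix M) (i j : ι) : 0 ≤ M⁻¹ i j :=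
  hM.isInverseMonotone.inv_nonneg i j

theorem IsMMatrix.of_inv_nonneg (hoff : ∀ i j, i ≠ j → M i j ≤ 0) (hdet : IsUnit M.det)
    (hinv : ∀ i j, 0 ≤ M⁻¹ i j) : IsMMatrix M := by
  -- The positive vector is `M⁻¹ *ᵥ 1`: a vanishing entry would be a zero row of `M⁻¹`.
  refine ⟨hoff, M⁻¹ *ᵥ 1, fun i => ?_, fun i => ?_⟩
  · have hrow : (M⁻¹ *ᵥ 1) i = ∑ j, M⁻¹ i j := by simp [Matrix.mulVec, dotProduct]
    rw [hrow]
    refine (Finset.sum_nonneg fun j _ => hinv i j).lt_of_ne' fun hsum => ?_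
    have hzero : ∀ j, M⁻¹ i j = 0 := fun j =>
      (Finset.sum_eq_zero_iff_of_nonneg fun j _ => hinv i j).mp hsum j (Finset.mem_univ j)
    have hone := congrFun₂ (Matrix.nonsing_inv_mul M hdet) i i
    simp [Matrix.mul_apply, hzero] at hone
  · rw [Matrix.mulVec_mulVec, Matrix.mul_nonsing_inv _ hdet, Matrix.one_mulVec]
    exact one_pos

end Inverse

namespace IsMMatrix

theorem transpose (hM : IsMMatrix M) : IsMMatrix Mᵀ := by
  classical
  refine of_inv_nonneg (fun i j hij => hM.off_diag_nonpos j i hij.symm) ?_ fun i j => ?_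
  · rw [Matrix.det_transpose]
    exact hM.isUnit_det
  · rw [← Matrix.transpose_nonsing_inv]
    exact hM.inv_nonneg j i

variable [DecidableEq ι]

theorem one_le_inv_mul_diag (hM : IsMMatrix M) (i : ι) : 1 ≤ M⁻¹ i i * M i i := by
  have hone := congrFun₂ (Matrix.nonsing_inv_mul M hM.isUnit_det) i i
  rw [Matrix.mul_apply, Matrix.one_apply_eq, ← Finset.add_sum_erase _ _ (Finset.mem_univ i)] at hone
  have hoff : ∑ j ∈ Finset.univ.erase i, M⁻¹ i j * M j i ≤ 0 :=
    Finset.sum_nonpos fun j hj => mul_nonpos_of_nonneg_of_nonpos (hM.inv_nonneg i j)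
      (hM.off_diag_nonpos j i (Finset.ne_of_mem_erase hj))
  linarith

theorem inv_diag_pos (hM : IsMMatrix M) (i : ι) : 0 < M⁻¹ i i :=
  pos_of_mul_pos_left (one_pos.trans_le (hM.one_le_inv_mul_diag i)) (hM.diag_pos i).le

section Fin

variable {n : ℕ} {M : Matrix (Fin (n + 1)) (Fin (n + 1)) R}

theorem inv_zero_zero_mul_det (hM : IsMMatrix M) :
    M⁻¹ 0 0 * M.det = (M.submatrix Fin.succ Fin.succ).det := by
  rw [Matrix.inv_def, Matrix.smul_apply, Matrix.adjugate_fin_succ_eq_det_submatrix,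
    Ring.inverse_eq_inv', smul_eq_mul, mul_right_comm, inv_mul_cancel₀ hM.isUnit_det.ne_zero]
  simp

theorem det_pos_of_fin : ∀ {n : ℕ} {M : Matrix (Fin n) (Fin n) R}, IsMMatrix M → 0 < M.det
  | 0, _, _ => by simp
  | n + 1, M, hM => by
    have hminor := det_pos_of_fin (hM.submatrix (Fin.succ_injective n))
    rw [← hM.inv_zero_zero_mul_det] at hminor
    exact pos_of_mul_pos_right hminor (hM.inv_diag_pos 0).le

theorem det_le_prod_diag_of_fin :
    ∀ {n : ℕ} {M : Matrix (Fin n) (Fin n) R}, IsMMatrix M → M.det ≤ ∏ i, M i i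
  | 0, _, _ => by simp
  | n + 1, M, hM => by
    have hminor := hM.submatrix (Fin.succ_injective n)
    calc M.det ≤ M⁻¹ 0 0 * M 0 0 * M.det :=
          le_mul_of_one_le_left hM.det_pos_of_fin.le (hM.one_le_inv_mul_diag 0)
      _ = M 0 0 * (M.submatrix Fin.succ Fin.succ).det := by
          rw [← hM.inv_zero_zero_mul_det]; ring
      _ ≤ M 0 0 * ∏ i : Fin n, M i.succ i.succ :=
          mul_le_mul_of_nonneg_left hminor.det_le_prod_diag_of_fin (hM.diag_pos 0).le
      _ = ∏ i, M i i := (Fin.prod_univ_succ fun i => M i i).symm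

end Fin

theorem det_pos (hM : IsMMatrix M) : 0 < M.det := by
  rw [← Matrix.det_submatrix_equiv_self (Fintype.equivFin ι).symm]
  exact (hM.submatrix (Fintype.equivFin ι).symm.injective).det_pos_of_fin

theorem det_le_prod_diag (hM : IsMMatrix M) : M.det ≤ ∏ i, M i i := by
  rw [← Matrix.det_submatrix_equiv_self (Fintype.equivFin ι).symm,
    ← (Fintype.equivFin ι).symm.prod_comp]
  exact (hM.submatrix (Fintype.equivFin ι).symm.injective).det_le_prod_diag_of_fin

end IsMMatrix

end MMatrix

section Connectedness

variable {ι X : Type*} [Fintype ι] [TopologicalSpace X] {M : X → Matrix ι ι ℝ}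

theorem isOpen_setOf_semipositive (hM : Continuous M) :
    IsOpen {a | ∃ x : ι → ℝ, (∀ i, 0 < x i) ∧ ∀ i, 0 < (M a *ᵥ x) i} := by
  simp only [Set.ofPred_exists, Set.ofPred_and]
  refine isOpen_iUnion fun x => isOpen_const.inter ?_
  rw [Set.ofPred_forall]
  exact isOpen_iInter_of_finite fun i =>
    isOpen_lt continuous_const ((continuous_apply i).comp (hM.matrix_mulVec continuous_const))

variable [DecidableEq ι]

theorem continuous_inv_apply_of_det_ne_zero (hM : Continuous M) (hdet : ∀ a, (M a).det ≠ 0)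
    (i j : ι) : Continuous fun a => (M a)⁻¹ i j := by
  simp only [Matrix.inv_def, Matrix.smul_apply, Ring.inverse_eq_inv', smul_eq_mul]
  exact (hM.matrix_det.inv₀ hdet).mul (hM.matrix_adjugate.matrix_elem i j)

/-- Within the nonsingular matrices with nonpositive off-diagonal entries, the M-matrices form an
open set by semipositivity, and a closed one by nonnegativity of the inverse. -/
theorem IsMMatrix.of_preconnectedSpace [PreconnectedSpace X] (hM : Continuous M)
    (hoff : ∀ a i j, i ≠ j → M a i j ≤ 0) (hdet : ∀ a, (M a).det ≠ 0) {a₀ : X}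
    (h₀ : IsMMatrix (M a₀)) (a : X) : IsMMatrix (M a) := by
  have hopen : IsOpen {a | IsMMatrix (M a)} := by
    have hsemi : {a | IsMMatrix (M a)} =
        {a | ∃ x : ι → ℝ, (∀ i, 0 < x i) ∧ ∀ i, 0 < (M a *ᵥ x) i} :=
      Set.ext fun a => ⟨semipositive, mk (hoff a)⟩
    exact hsemi ▸ isOpen_setOf_semipositive hM
  have hclosed : IsClosed {a | IsMMatrix (M a)} := by
    have hinv : {a | IsMMatrix (M a)} = {a | ∀ i j, 0 ≤ (M a)⁻¹ i j} := Set.ext fun a =>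
      ⟨fun h => h.inv_nonneg, of_inv_nonneg (hoff a) (hdet a).isUnit⟩
    simp only [hinv, Set.ofPred_forall]
    exact isClosed_iInter fun i => isClosed_iInter fun j =>
      isClosed_le continuous_const (continuous_inv_apply_of_det_ne_zero hM hdet i j)
  exact Set.eq_univ_iff_forall.mp (IsClopen.eq_univ ⟨hclosed, hopen⟩ ⟨a₀, h₀⟩) a

end Connectedness

section Spectrum

open Finset in
theorem norm_neg_log_one_sub_sub_self_le {z : ℂ} {ρ : ℝ} (hz : ‖z‖ ≤ ρ) (hρ : ρ < 1) :
    ‖-Complex.log (1 - z) - z‖ ≤ -Real.log (1 - ρ) - ρ := by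
  have hρ' : |ρ| < 1 := by rwa [abs_of_nonneg ((norm_nonneg z).trans hz)]
  have hcomplex : HasSum (fun k : ℕ => z ^ (k + 2) / ↑(k + 2)) (-Complex.log (1 - z) - z) := by
    simpa [sum_range_succ] using
      (hasSum_nat_add_iff' 2).mpr (Complex.hasSum_taylorSeries_neg_log (hz.trans_lt hρ))
  have hreal : HasSum (fun k : ℕ => ρ ^ (k + 2) / ((k + 1 : ℕ) + 1 : ℝ))
      (-Real.log (1 - ρ) - ρ) := by
    simpa using (hasSum_nat_add_iff' 1).mpr (Real.hasSum_pow_div_log_of_abs_lt_one hρ')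
  refine hcomplex.norm_le_of_bounded hreal fun k => ?_
  rw [norm_div, norm_pow, Complex.norm_natCast]
  push_cast
  rw [add_assoc (k : ℝ) 1 1, one_add_one_eq_two]
  gcongr

theorem one_sub_mul_exp_le_norm_one_add {z : ℂ} {ρ : ℝ} (hz : ‖z‖ ≤ ρ) (hρ : ρ < 1) :
    (1 - ρ) * Real.exp (ρ + z.re) ≤ ‖1 + z‖ := by
  have hpos : 0 < ‖1 + z‖ := by
    refine norm_pos_iff.mpr fun h => ?_
    rw [eq_neg_of_add_eq_zero_right h, norm_neg, norm_one] at hz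
    exact hz.not_gt hρ
  have hlog : -Real.log ‖1 + z‖ + z.re ≤ -Real.log (1 - ρ) - ρ := by
    have hbound := (Complex.re_le_norm _).trans
      (norm_neg_log_one_sub_sub_self_le (z := -z) (by rwa [norm_neg]) hρ)
    simpa [Complex.log_re] using hbound
  calc (1 - ρ) * Real.exp (ρ + z.re)
      = Real.exp (Real.log (1 - ρ) + (ρ + z.re)) := by
        rw [Real.exp_add (Real.log _), Real.exp_log (sub_pos.mpr hρ)]
    _ ≤ Real.exp (Real.log ‖1 + z‖) := Real.exp_le_exp.mpr (by linarith)
    _ = ‖1 + z‖ := Real.exp_log hpos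

theorem mul_log_one_sub_le {ρ : ℝ} (hρ : ρ < 1) :
    ρ * Real.log (1 - ρ) ≤ Real.log (1 - ρ) + ρ := by
  have hpos : 0 < 1 - ρ := sub_pos.mpr hρ
  have hlog := mul_le_mul_of_nonneg_left (Real.one_sub_inv_le_log_of_pos hpos) hpos.le
  rw [mul_sub, mul_inv_cancel₀ hpos.ne'] at hlog
  linarith

variable {ι : Type*} [Fintype ι] [DecidableEq ι]

theorem card_roots_charpoly {K : Type*} [Field K] [IsAlgClosed K] (C : Matrix ι ι K) :
    C.charpoly.roots.card = Fintype.card ι := by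
  rw [← (IsAlgClosed.splits C.charpoly).natDegree_eq_card_roots,
    Matrix.charpoly_natDegree_eq_dim]

theorem det_one_add_eq_prod_roots_charpoly {K : Type*} [Field K] [IsAlgClosed K]
    (C : Matrix ι ι K) : (1 + C).det = (C.charpoly.roots.map fun z => 1 + z).prod := by
  have heval := (IsAlgClosed.splits C.charpoly).eval_eq_prod_roots_of_monic C.charpoly_monic (-1)
  have hscalar : Matrix.scalar ι (-1 : K) - C = -(1 + C) := by
    rw [map_neg, map_one]; abel
  have hroots : (C.charpoly.roots.map fun z => -1 - z).prod =
      (-1) ^ Fintype.card ι * (C.charpoly.roots.map fun z => 1 + z).prod := by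
    rw [← card_roots_charpoly C, ← Multiset.prod_replicate, ← Multiset.map_const',
      ← Multiset.prod_map_mul]
    exact congrArg _ (Multiset.map_congr rfl fun z _ => by ring)
  rw [Matrix.eval_charpoly, hscalar, Matrix.det_neg, hroots] at heval
  exact mul_left_cancel₀ (pow_ne_zero _ (neg_ne_zero.mpr one_ne_zero)) heval

theorem pow_card_mul_exp_re_trace_le_norm_det_one_add (C : Matrix ι ι ℂ) {ρ : ℝ} (hρ : ρ < 1)
    (hC : ∀ z ∈ spectrum ℂ C, ‖z‖ ≤ ρ) :
    ((1 - ρ) * Real.exp ρ) ^ Fintype.card ι * Real.exp C.trace.re ≤ ‖(1 + C).det‖ := by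
  set s := C.charpoly.roots
  have htrace : Real.exp C.trace.re = (s.map fun z => Real.exp z.re).prod := by
    have hre : C.trace.re = (s.map Complex.re).sum := by
      rw [C.trace_eq_sum_roots_charpoly]
      exact map_multiset_sum Complex.reAddGroupHom s
    rw [hre, Real.exp_multiset_sum, Multiset.map_map]
    rfl
  have hdet : ‖(1 + C).det‖ = (s.map fun z => ‖1 + z‖).prod := by
    rw [det_one_add_eq_prod_roots_charpoly]
    exact (map_multiset_prod (normHom : ℂ →*₀ ℝ) _).trans (congrArg _ (Multiset.map_map ..))
  rw [htrace, hdet, ← card_roots_charpoly C, ← Multiset.prod_replicate, ← Multiset.map_const',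
    ← Multiset.prod_map_mul]
  refine Multiset.prod_map_le_prod_map₀ _ _ (fun z _ => ?_) fun z hz => ?_
  · have := sub_pos.mpr hρ
    positivity
  · rw [mul_assoc, ← Real.exp_add]
    exact one_sub_mul_exp_le_norm_one_add
      (hC z (Matrix.mem_spectrum_of_isRoot_charpoly (Polynomial.isRoot_of_mem_roots hz))) hρ

attribute [local instance] Matrix.linftyOpNormedRing Matrix.linftyOpNormedAlgebra in
theorem spectralRadius_lt_one_of_sum_norm_mul_lt {𝕜 : Type*} [RCLike 𝕜] {C : Matrix ι ι 𝕜}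
    {x : ι → ℝ} (hx : ∀ i, 0 < x i) (hC : ∀ i, ∑ j, ‖C i j‖ * x j < x i) :
    spectralRadius 𝕜 C < 1 := by
  cases isEmpty_or_nonempty ι
  · rw [spectrum.SpectralRadius.of_subsingleton]
    exact one_pos
  -- Conjugation with the diagonal matrix of `x` makes all absolute row sums less than one.
  have hx' : ∀ i, (x i : 𝕜) ≠ 0 := fun i => RCLike.ofReal_ne_zero.mpr (hx i).ne'
  let D : (Matrix ι ι 𝕜)ˣ :=
    { val := Matrix.diagonal fun i => (x i : 𝕜)⁻¹
      inv := Matrix.diagonal fun i => (x i : 𝕜)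
      val_inv := by simp [hx']
      inv_val := by simp [hx'] }
  have hD : ∀ i j, (D.val * C * D⁻¹.val) i j = (x i : 𝕜)⁻¹ * C i j * x j := fun i j => by
    simp [D, Matrix.mul_diagonal, Matrix.diagonal_mul]
  have hnorm : ‖D.val * C * D⁻¹.val‖₊ < 1 := by
    rw [Matrix.linfty_opNNNorm_def, Finset.sup_lt_iff one_pos]
    intro i _
    rw [← NNReal.coe_lt_coe, NNReal.coe_sum, NNReal.coe_one]
    calc ∑ j, ‖(D.val * C * D⁻¹.val) i j‖ = (∑ j, ‖C i j‖ * x j) / x i := by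
          rw [Finset.sum_div]
          refine Finset.sum_congr rfl fun j _ => ?_
          rw [hD, norm_mul, norm_mul, norm_inv, RCLike.norm_of_nonneg (hx i).le,
            RCLike.norm_of_nonneg (hx j).le]
          ring
      _ < 1 := (div_lt_one (hx i)).mpr (hC i)
  calc spectralRadius 𝕜 C = spectralRadius 𝕜 (D.val * C * D⁻¹.val) := by
        simp only [spectralRadius, spectrum.units_conjugate]
    _ ≤ ‖D.val * C * D⁻¹.val‖₊ := spectrum.spectralRadius_le_nnnorm _
    _ < 1 := mod_cast hnorm

theorem spectralRadius_ne_top {𝕜 : Type*} [NormedField 𝕜] (C : Matrix ι ι 𝕜) :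
    spectralRadius 𝕜 C ≠ ⊤ := by
  have := Matrix.finite_spectrum C
  rw [spectralRadius, iSup_subtype']
  exact (ENNReal.iSup_coe_lt_top.mpr (Set.finite_range _).bddAbove).ne

end Spectrum

namespace RadialGrid

section JacobiMatrix

variable {n : ℕ} {M C : Matrix (Fin n) (Fin n) ℝ}

theorem norm_le_specRad {z : ℂ} (hz : z ∈ spectrum ℂ (C.map (algebraMap ℝ ℂ))) :
    ‖z‖ ≤ specRad C :=
  ENNReal.toReal_mono (spectralRadius_ne_top _) (le_iSup₂ (f := fun k _ => (‖k‖₊ : ENNReal)) z hz)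

theorem specRad_lt_one_of_sum_abs_mul_lt {x : Fin n → ℝ} (hx : ∀ i, 0 < x i)
    (hC : ∀ i, ∑ j, |C i j| * x j < x i) : specRad C < 1 := by
  have hlt : spectralRadius ℂ (C.map (algebraMap ℝ ℂ)) < 1 :=
    spectralRadius_lt_one_of_sum_norm_mul_lt hx fun i => by simpa using hC i
  simpa [specRad] using ENNReal.toReal_strict_mono ENNReal.one_ne_top hlt

theorem pow_mul_exp_trace_le_abs_det_one_add (hC : specRad C < 1) :
    ((1 - specRad C) * Real.exp (specRad C)) ^ n * Real.exp C.trace ≤ |(1 + C).det| := by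
  have htrace : (C.map (algebraMap ℝ ℂ)).trace = C.trace :=
    (AddMonoidHom.map_trace (algebraMap ℝ ℂ).toAddMonoidHom C).symm
  have hdet : (1 + C.map (algebraMap ℝ ℂ)).det = (1 + C).det := by
    rw [← Complex.coe_algebraMap, RingHom.map_det, map_add, map_one]
    rfl
  have hbound := pow_card_mul_exp_re_trace_le_norm_det_one_add (C.map (algebraMap ℝ ℂ)) hC
    fun z => norm_le_specRad
  rwa [htrace, hdet, Complex.ofReal_re, Complex.norm_real, Real.norm_eq_abs,
    Fintype.card_fin] at hbound

/-- The matrix `D⁻¹ (M - D)`, where `D` is the diagonal part of `M`. Its negative is the iteration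
matrix of Jacobi's method for `M`. -/
noncomputable def jacobiMatrix (M : Matrix (Fin n) (Fin n) ℝ) : Matrix (Fin n) (Fin n) ℝ :=
  (diagPart M)⁻¹ * offPart M

theorem diagPart_mul_jacobiMatrix (hM : ∀ i, M i i ≠ 0) :
    diagPart M * jacobiMatrix M = offPart M := by
  have hdet : IsUnit (diagPart M).det := by
    rw [isUnit_iff_ne_zero, diagPart, Matrix.det_diagonal]
    exact Finset.prod_ne_zero_iff.mpr fun i _ => hM i
  rw [jacobiMatrix, ← Matrix.mul_assoc, Matrix.mul_nonsing_inv _ hdet, Matrix.one_mul]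

theorem diag_mul_jacobiMatrix_apply (hM : ∀ i, M i i ≠ 0) (i j : Fin n) :
    M i i * jacobiMatrix M i j = offPart M i j := by
  rw [← diagPart_mul_jacobiMatrix hM, diagPart, Matrix.diagonal_mul, Matrix.diag_apply]

theorem offPart_apply_self (i : Fin n) : offPart M i i = 0 := by
  simp [offPart, diagPart]

theorem offPart_apply_of_ne {i j : Fin n} (hij : i ≠ j) : offPart M i j = M i j := by
  simp [offPart, diagPart, hij]

theorem trace_jacobiMatrix (hM : ∀ i, M i i ≠ 0) : (jacobiMatrix M).trace = 0 :=
  Finset.sum_eq_zero fun i _ => (mul_eq_zero_iff_left (hM i)).mp <|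
    (diag_mul_jacobiMatrix_apply hM i i).trans (offPart_apply_self i)

theorem det_eq_prod_diag_mul_det_one_add_jacobiMatrix (hM : ∀ i, M i i ≠ 0) :
    M.det = (∏ i, M i i) * (1 + jacobiMatrix M).det := by
  have hfactor : M = diagPart M * (1 + jacobiMatrix M) := by
    rw [Matrix.mul_add, diagPart_mul_jacobiMatrix hM, Matrix.mul_one, offPart, add_sub_cancel]
  have hdiag : (diagPart M).det = ∏ i, M i i := Matrix.det_diagonal
  rw [← hdiag, ← Matrix.det_mul, ← hfactor]

end JacobiMatrix

end RadialGrid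

namespace IsMMatrix

open RadialGrid

variable {n : ℕ} {M : Matrix (Fin n) (Fin n) ℝ}

theorem sum_abs_jacobiMatrix_mul_lt (hM : IsMMatrix M) {x : Fin n → ℝ}
    (hMx : ∀ i, 0 < (M *ᵥ x) i) (i : Fin n) : ∑ j, |jacobiMatrix M i j| * x j < x i := by
  have hdiag := hM.diag_pos
  have habs : ∀ j, M i i * |jacobiMatrix M i j| = -offPart M i j := fun j => by
    have hoff : offPart M i j ≤ 0 := by
      obtain rfl | hij := eq_or_ne i j
      · exact (offPart_apply_self i).le
      · exact (offPart_apply_of_ne hij).trans_le (hM.off_diag_nonpos i j hij)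
    rw [← abs_of_nonpos hoff, ← diag_mul_jacobiMatrix_apply fun i => (hdiag i).ne', abs_mul,
      abs_of_pos (hdiag i)]
  refine lt_of_mul_lt_mul_left ?_ (hdiag i).le
  calc M i i * ∑ j, |jacobiMatrix M i j| * x j = -(offPart M *ᵥ x) i := by
        simp only [Finset.mul_sum, ← mul_assoc, habs, neg_mul, Finset.sum_neg_distrib,
          Matrix.mulVec, dotProduct]
    _ = M i i * x i - (M *ᵥ x) i := by
        rw [offPart, diagPart, Matrix.sub_mulVec, Pi.sub_apply, Matrix.mulVec_diagonal,
          Matrix.diag_apply, neg_sub]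
    _ < M i i * x i := sub_lt_self _ (hMx i)

theorem specRad_jacobiMatrix_lt_one (hM : IsMMatrix M) : specRad (jacobiMatrix M) < 1 := by
  obtain ⟨x, hx, hMx⟩ := hM.semipositive
  exact specRad_lt_one_of_sum_abs_mul_lt hx (hM.sum_abs_jacobiMatrix_mul_lt hMx)

theorem log_det_le_log_prod_diag (hM : IsMMatrix M) : Real.log M.det ≤ Real.log (∏ i, M i i) :=
  Real.log_le_log hM.det_pos hM.det_le_prod_diag

theorem log_prod_diag_le (hM : IsMMatrix M) :
    Real.log (∏ i, M i i) ≤ Real.log M.det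
      - n * (specRad (jacobiMatrix M) * Real.log (1 - specRad (jacobiMatrix M))) := by
  set ρ := specRad (jacobiMatrix M)
  have hlt : ρ < 1 := hM.specRad_jacobiMatrix_lt_one
  have hpos : 0 < 1 - ρ := sub_pos.mpr hlt
  have hdiag : ∀ i, M i i ≠ 0 := fun i => (hM.diag_pos i).ne'
  have hprod : 0 < ∏ i, M i i := Finset.prod_pos fun i _ => hM.diag_pos i
  have hdet := det_eq_prod_diag_mul_det_one_add_jacobiMatrix hdiag
  have hdetC : 0 < (1 + jacobiMatrix M).det :=
    pos_of_mul_pos_right (hdet ▸ hM.det_pos) hprod.le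
  have hlower : ((1 - ρ) * Real.exp ρ) ^ n ≤ (1 + jacobiMatrix M).det := by
    simpa [trace_jacobiMatrix hdiag, abs_of_pos hdetC] using
      pow_mul_exp_trace_le_abs_det_one_add hlt
  have hlog : n * (Real.log (1 - ρ) + ρ) ≤ Real.log (1 + jacobiMatrix M).det := by
    calc n * (Real.log (1 - ρ) + ρ) = Real.log (((1 - ρ) * Real.exp ρ) ^ n) := by
          rw [Real.log_pow, Real.log_mul hpos.ne' (Real.exp_ne_zero ρ), Real.log_exp]
      _ ≤ Real.log (1 + jacobiMatrix M).det := Real.log_le_log (by positivity) hlower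
  have hentropy := mul_le_mul_of_nonneg_left (mul_log_one_sub_le hlt) n.cast_nonneg
  rw [hdet, Real.log_mul hprod.ne' hdetC.ne']
  linarith

end IsMMatrix

namespace RadialGrid

theorem diagonal_mulVec_eq_mul {ι R : Type*} [Fintype ι] [DecidableEq ι]
    [NonUnitalNonAssocSemiring R] (a b : ι → R) : Matrix.diagonal a *ᵥ b = a * b :=
  funext (Matrix.mulVec_diagonal a b)

namespace Network

variable {n : ℕ} (G : Network n)

section Incidence

theorem Aout₂_nonneg (i j : Fin n) : 0 ≤ G.Aout₂ i j := by
  simp only [Aout₂, Aout, Matrix.submatrix_apply, Matrix.of_apply]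
  split_ifs <;> norm_num

theorem A₂_eq_sub_one : G.A₂ = G.Aout₂ - 1 := by
  ext i j
  simp [A₂, A, Aout₂, Ain, Matrix.one_apply]

theorem Aout_transpose_mulVec_apply (v : Fin (n + 1) → ℝ) (e : Fin n) :
    (G.Aoutᵀ *ᵥ v) e = v (G.parent e) := by
  simp [Matrix.mulVec, dotProduct, Aout]

theorem Ain_transpose_mulVec_apply (v : Fin (n + 1) → ℝ) (e : Fin n) :
    (G.Ainᵀ *ᵥ v) e = v e.succ := by
  simp [Matrix.mulVec, dotProduct, Ain]

theorem Aout₂_transpose_mulVec (v : Fin n → ℝ) :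
    G.Aout₂ᵀ *ᵥ v = G.Aoutᵀ *ᵥ (Fin.cons 0 v : Fin (n + 1) → ℝ) := by
  ext e
  simp [Matrix.mulVec, dotProduct, Aout₂, Fin.sum_univ_succ]

theorem A₂_transpose_mulVec (v : Fin n → ℝ) : G.A₂ᵀ *ᵥ v = G.Aout₂ᵀ *ᵥ v - v := by
  rw [A₂_eq_sub_one, Matrix.transpose_sub, Matrix.transpose_one, Matrix.sub_mulVec,
    Matrix.one_mulVec]

theorem isInverseMonotone_neg_A₂_transpose : IsInverseMonotone (-G.A₂ᵀ) := by
  -- Extended by zero at the root, `v` does not decrease along the edges of the tree.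
  intro v hv
  have hextend : ∀ j, 0 ≤ (Fin.cons 0 v : Fin (n + 1) → ℝ) j := by
    intro j
    induction G.rooted j with
    | refl => simp
    | tail _ hedge hparent =>
      obtain ⟨e, rfl, rfl⟩ := hedge
      have hdrop := hv e
      rw [Matrix.neg_mulVec, A₂_transpose_mulVec, Aout₂_transpose_mulVec, neg_sub, Pi.sub_apply,
        Aout_transpose_mulVec_apply, Pi.zero_apply, sub_nonneg] at hdrop
      exact hparent.trans hdrop
  exact fun e => hextend e.succ

theorem isMMatrix_neg_A₂ : IsMMatrix (-G.A₂) := by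
  have hmono := G.isInverseMonotone_neg_A₂_transpose
  have htranspose : IsMMatrix (-G.A₂ᵀ) := by
    refine .of_inv_nonneg (fun i j hij => ?_) hmono.isUnit_det hmono.inv_nonneg
    simpa [A₂_eq_sub_one, Matrix.one_apply_ne hij] using G.Aout₂_nonneg j i
  exact htranspose.transpose

theorem isUnit_det_A₂ : IsUnit G.A₂.det := by
  have hunit := G.isMMatrix_neg_A₂.isUnit_det
  rwa [← Matrix.isUnit_iff_isUnit_det, IsUnit.neg_iff, Matrix.isUnit_iff_isUnit_det] at hunit

theorem inv_neg_A₂ : (-G.A₂)⁻¹ = -G.A₂⁻¹ :=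
  Matrix.inv_eq_left_inv <| by rw [neg_mul_neg, Matrix.nonsing_inv_mul _ G.isUnit_det_A₂]

theorem inv_A₂_nonpos (i j : Fin n) : G.A₂⁻¹ i j ≤ 0 := by
  simpa [inv_neg_A₂] using G.isMMatrix_neg_A₂.inv_nonneg i j

theorem inv_A₂_diag_le_neg_one (i : Fin n) : G.A₂⁻¹ i i ≤ -1 := by
  have hdiag : (-G.A₂) i i ≤ 1 := by
    simpa [A₂_eq_sub_one] using G.Aout₂_nonneg i i
  have hinv : 1 ≤ (-G.A₂)⁻¹ i i :=
    (G.isMMatrix_neg_A₂.one_le_inv_mul_diag i).trans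
      (mul_le_of_le_one_right (G.isMMatrix_neg_A₂.inv_nonneg i i) hdiag)
  rw [inv_neg_A₂, Matrix.neg_apply] at hinv
  exact le_neg_of_le_neg hinv

theorem balance_succ (f d : Fin n → ℝ) (e : Fin n) :
    (G.Ain *ᵥ (f - d) - G.Aout *ᵥ f) e.succ = (-G.A₂ *ᵥ f) e - d e := by
  have hin : ∀ g : Fin n → ℝ, (G.Ain *ᵥ g) e.succ = g e := fun g => by
    simp [Matrix.mulVec, dotProduct, Ain]
  have hout : (G.Aout *ᵥ f) e.succ = (G.Aout₂ *ᵥ f) e := rfl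
  rw [A₂_eq_sub_one, neg_sub, Matrix.sub_mulVec, Matrix.one_mulVec, Pi.sub_apply, Pi.sub_apply,
    hin, hout, Pi.sub_apply]
  ring

end Incidence

section SignPattern

theorem flow_nonneg_of_balance {f loss demand : Fin n → ℝ} (hloss : 0 ≤ loss)
    (hdemand : 0 ≤ demand)
    (hbalance : ∀ e, (G.Ain *ᵥ (f - loss) - G.Aout *ᵥ f) e.succ = demand e) : 0 ≤ f := by
  refine G.isMMatrix_neg_A₂.isInverseMonotone f fun e => ?_
  have heq := hbalance e
  rw [balance_succ, sub_eq_iff_eq_add] at heq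
  rw [heq]
  exact add_nonneg (hdemand e) (hloss e)

theorem diagonal_mul_inv_A₂_mul_diagonal_nonpos {a b : Fin n → ℝ} (ha : 0 ≤ a) (hb : 0 ≤ b)
    (i j : Fin n) : (Matrix.diagonal a * G.A₂⁻¹ * Matrix.diagonal b) i j ≤ 0 := by
  rw [Matrix.mul_diagonal, Matrix.diagonal_mul]
  exact mul_nonpos_of_nonpos_of_nonneg
    (mul_nonpos_of_nonneg_of_nonpos (ha i) (G.inv_A₂_nonpos i j)) (hb j)

theorem diagonal_sq_add_two_smul_nonpos {a : Fin n → ℝ} (ha : 0 ≤ a) (i j : Fin n) :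
    (Matrix.diagonal a ^ 2 + (2 : ℝ) • (Matrix.diagonal a * G.A₂⁻¹ * Matrix.diagonal a)) i j
      ≤ 0 := by
  rw [Matrix.diagonal_pow, Matrix.add_apply, Matrix.smul_apply, smul_eq_mul]
  obtain rfl | hij := eq_or_ne i j
  · have hself : (Matrix.diagonal a * G.A₂⁻¹ * Matrix.diagonal a) i i ≤ -(a i) ^ 2 := by
      rw [Matrix.mul_diagonal, Matrix.diagonal_mul, mul_right_comm, ← sq]
      simpa using mul_le_mul_of_nonneg_left (G.inv_A₂_diag_le_neg_one i) (sq_nonneg (a i))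
    rw [Matrix.diagonal_apply_eq, Pi.pow_apply]
    linarith [sq_nonneg (a i)]
  · rw [Matrix.diagonal_apply_ne _ hij]
    linarith [G.diagonal_mul_inv_A₂_mul_diagonal_nonpos ha ha i j]

theorem Aout₂_transpose_mul_inv_A₂_transpose_nonpos (i j : Fin n) :
    (G.Aout₂ᵀ * (G.A₂ᵀ)⁻¹) i j ≤ 0 := by
  rw [← Matrix.transpose_nonsing_inv, Matrix.mul_apply]
  exact Finset.sum_nonpos fun k _ =>
    mul_nonpos_of_nonneg_of_nonpos (G.Aout₂_nonneg k i) (G.inv_A₂_nonpos j k)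

variable {G} {w : Vars n × Params n}

theorem pLine_nonneg (hw : w ∈ G.operatingPoints) : 0 ≤ pLine w.1 := by
  obtain ⟨hphi, -, -, hcur, hp, -⟩ := hw
  exact G.flow_nonneg_of_balance (fun e => mul_nonneg (G.r_nonneg e) (hcur e)) hp
    fun e => sub_eq_zero.mp (congrFun hphi (.inl e.succ))

theorem qLine_nonneg (hw : w ∈ G.operatingPoints) : 0 ≤ qLine w.1 := by
  obtain ⟨hphi, -, -, hcur, -, hq⟩ := hw
  exact G.flow_nonneg_of_balance (fun e => mul_nonneg (G.x_nonneg e) (hcur e)) hq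
    fun e => sub_eq_zero.mp (congrFun hphi (.inr (.inl e.succ)))

theorem redJac_off_diag_nonpos (hw : w ∈ G.operatingPoints) {i j : Fin n} (hij : i ≠ j) :
    G.redJac w.1 w.2 i j ≤ 0 := by
  have hp := G.diagonal_mul_inv_A₂_mul_diagonal_nonpos (pLine_nonneg hw) G.r_nonneg i j
  have hq := G.diagonal_mul_inv_A₂_mul_diagonal_nonpos (qLine_nonneg hw) G.x_nonneg i j
  set K := Matrix.diagonal G.r ^ 2
    + (2 : ℝ) • (Matrix.diagonal G.r * G.A₂⁻¹ * Matrix.diagonal G.r)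
    + Matrix.diagonal G.x ^ 2 + (2 : ℝ) • (Matrix.diagonal G.x * G.A₂⁻¹ * Matrix.diagonal G.x)
    with hK
  have hK_nonpos : ∀ i j, K i j ≤ 0 := fun i j => by
    rw [hK, add_assoc (_ + _), Matrix.add_apply]
    exact add_nonpos (G.diagonal_sq_add_two_smul_nonpos G.r_nonneg i j)
      (G.diagonal_sq_add_two_smul_nonpos G.x_nonneg i j)
  have hvolt : 0 ≤ (Matrix.diagonal (cur w.1) * G.Aout₂ᵀ * (G.A₂ᵀ)⁻¹ * K) i j := by
    rw [Matrix.mul_assoc (Matrix.diagonal _), Matrix.mul_assoc, Matrix.diagonal_mul,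
      Matrix.mul_apply]
    exact mul_nonneg (hw.2.2.2.1 i) <| Finset.sum_nonneg fun k _ =>
      mul_nonneg_of_nonpos_of_nonpos (G.Aout₂_transpose_mul_inv_A₂_transpose_nonpos i k)
        (hK_nonpos k j)
  rw [redJac, ← hK, Matrix.sub_apply, Matrix.add_apply, Matrix.add_apply, Matrix.smul_apply,
    Matrix.smul_apply, Matrix.diagonal_apply_ne _ hij, smul_eq_mul, smul_eq_mul]
  linarith

end SignPattern

section SchurComplement

/-- The change of the line powers that balances a change `l` of the squared currents when the
losses are `c * l` and the demands at the buses `1, …, n` are fixed. The vector `c` is `G.r` for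
active and `G.x` for reactive power. -/
noncomputable def flowResponse (c l : Fin n → ℝ) : Fin n → ℝ :=
  -(G.A₂⁻¹ *ᵥ (c * l))

/-- The change of the squared voltages at the buses `1, …, n` that satisfies the linearized voltage
drop equations under a change `l` of the squared currents, the voltage at the root being fixed. -/
noncomputable def voltResponse (l : Fin n → ℝ) : Fin n → ℝ :=
  (G.A₂ᵀ)⁻¹ *ᵥ ((2 : ℝ) • (G.r * G.flowResponse G.r l + G.x * G.flowResponse G.x l)
    - (G.r ^ 2 + G.x ^ 2) * l)

/-- The change of all system variables determined by a change `l` of the squared currents through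
the linearized balance and voltage drop equations. -/
noncomputable def currentResponse (l : Fin n → ℝ) : Vars n :=
  Sum.elim (G.flowResponse G.r l) <| Sum.elim (G.flowResponse G.x l) <| Sum.elim l <|
  Sum.elim (G.voltResponse l) <|
  Sum.elim (fun _ => -(G.Aout *ᵥ G.flowResponse G.r l) 0)
    (fun _ => -(G.Aout *ᵥ G.flowResponse G.x l) 0)

theorem balance_flowResponse (c l : Fin n → ℝ) :
    G.Ain *ᵥ (G.flowResponse c l - c * l) - G.Aout *ᵥ G.flowResponse c l =
      (Fin.cons (-(G.Aout *ᵥ G.flowResponse c l) 0) 0 : Fin (n + 1) → ℝ) := by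
  ext j
  refine Fin.cases ?_ (fun e => ?_) j
  · simp [Matrix.mulVec, dotProduct, Ain, (Fin.succ_ne_zero _).symm]
  · rw [balance_succ, flowResponse, Matrix.neg_mulVec, Matrix.mulVec_neg, neg_neg,
      Matrix.mulVec_mulVec, Matrix.mul_nonsing_inv _ G.isUnit_det_A₂, Matrix.one_mulVec, sub_self]
    rfl

theorem voltDrop_voltResponse (l : Fin n → ℝ) :
    G.Aoutᵀ *ᵥ (Fin.cons 0 (G.voltResponse l) : Fin (n + 1) → ℝ)
      - (2 : ℝ) • (G.r * G.flowResponse G.r l + G.x * G.flowResponse G.x l)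
      + (G.r ^ 2 + G.x ^ 2) * l
      - G.Ainᵀ *ᵥ (Fin.cons 0 (G.voltResponse l) : Fin (n + 1) → ℝ) = 0 := by
  have hdet : IsUnit (G.A₂ᵀ).det := by
    rw [Matrix.det_transpose]
    exact G.isUnit_det_A₂
  have hsolve : G.A₂ᵀ *ᵥ G.voltResponse l =
      (2 : ℝ) • (G.r * G.flowResponse G.r l + G.x * G.flowResponse G.x l)
        - (G.r ^ 2 + G.x ^ 2) * l := by
    rw [voltResponse, Matrix.mulVec_mulVec, Matrix.mul_nonsing_inv _ hdet, Matrix.one_mulVec]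
  have hAin : G.Ainᵀ *ᵥ (Fin.cons 0 (G.voltResponse l) : Fin (n + 1) → ℝ) = G.voltResponse l :=
    funext fun e => G.Ain_transpose_mulVec_apply _ e
  rw [A₂_transpose_mulVec] at hsolve
  rw [hAin, ← Aout₂_transpose_mulVec, eq_add_of_sub_eq hsolve]
  abel

theorem voltResponse_eq (l : Fin n → ℝ) :
    G.voltResponse l = -((G.A₂ᵀ)⁻¹ *ᵥ ((Matrix.diagonal G.r ^ 2
      + (2 : ℝ) • (Matrix.diagonal G.r * G.A₂⁻¹ * Matrix.diagonal G.r) + Matrix.diagonal G.x ^ 2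
      + (2 : ℝ) • (Matrix.diagonal G.x * G.A₂⁻¹ * Matrix.diagonal G.x)) *ᵥ l)) := by
  rw [voltResponse, ← Matrix.mulVec_neg]
  congr 1
  simp only [flowResponse, Matrix.add_mulVec, Matrix.smul_mulVec, ← Matrix.mulVec_mulVec,
    Matrix.diagonal_pow, diagonal_mulVec_eq_mul, mul_neg, add_mul, smul_add, smul_neg]
  abel

theorem redJac_mulVec (u : Vars n) (ξ : Params n) (l : Fin n → ℝ) :
    G.redJac u ξ *ᵥ l = (G.Aoutᵀ *ᵥ volt u ξ) * l + cur u * (G.Aout₂ᵀ *ᵥ G.voltResponse l)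
      - (2 : ℝ) • (pLine u * G.flowResponse G.r l + qLine u * G.flowResponse G.x l) := by
  simp only [voltResponse_eq, redJac, Matrix.sub_mulVec, Matrix.add_mulVec _ _ l,
    Matrix.smul_mulVec, ← Matrix.mulVec_mulVec, diagonal_mulVec_eq_mul, flowResponse,
    Matrix.mulVec_neg, mul_neg, smul_add, smul_neg]
  abel

theorem jacBlocks_mulVec_currentResponse (u : Vars n) (ξ : Params n) (l : Fin n → ℝ) :
    G.jacBlocks u ξ *ᵥ G.currentResponse l =
      (Sum.elim 0 (Sum.elim 0 (Sum.elim 0 (-(G.redJac u ξ *ᵥ l)))) : EqIdx n → ℝ) := by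
  rw [jacBlocks_mulVec, redJac_mulVec, Aout₂_transpose_mulVec, mul_comm (cur u)]
  congr 1
  · exact sub_eq_zero.mpr (G.balance_flowResponse G.r l)
  congr 1
  · exact sub_eq_zero.mpr (G.balance_flowResponse G.x l)
  congr 1
  · exact G.voltDrop_voltResponse l
  · change (2 : ℝ) • (pLine u * G.flowResponse G.r l + qLine u * G.flowResponse G.x l)
      - (G.Aoutᵀ *ᵥ volt u ξ) * l
      - (G.Aoutᵀ *ᵥ (Fin.cons 0 (G.voltResponse l) : Fin (n + 1) → ℝ)) * cur u = _
    abel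

variable {G}

theorem det_redJac_ne_zero {u : Vars n} {ξ : Params n} (hjac : (G.jac u ξ).det ≠ 0) :
    (G.redJac u ξ).det ≠ 0 := by
  contrapose! hjac
  obtain ⟨l, hl, hker⟩ := Matrix.exists_mulVec_eq_zero_iff.mpr hjac
  refine Matrix.exists_mulVec_eq_zero_iff.mp
    ⟨G.currentResponse l ∘ (varOrder n).symm, fun hzero => hl (funext fun e => ?_), ?_⟩
  · simpa [currentResponse] using congrFun hzero (varOrder n (.inr (.inr (.inl e))))
  · have hblocks : G.jacBlocks u ξ *ᵥ G.currentResponse l = 0 := by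
      rw [jacBlocks_mulVec_currentResponse, hker, neg_zero, Sum.elim_zero_zero, Sum.elim_zero_zero,
        Sum.elim_zero_zero]
    rw [jac, Matrix.reindex_apply, Matrix.submatrix_mulVec_equiv, Function.comp_assoc,
      Equiv.symm_symm, Equiv.symm_comp_self, Function.comp_id, hblocks]
    rfl

end SchurComplement

section StabilityRegion

theorem continuous_redJac : Continuous fun w : Vars n × Params n => G.redJac w.1 w.2 := by
  have hv : Continuous fun w : Vars n × Params n => volt w.1 w.2 := by
    refine continuous_pi fun j => ?_
    refine Fin.cases ?_ (fun e => ?_) j <;> simp only [volt, Fin.cons_zero, Fin.cons_succ] <;>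
      fun_prop
  have hp : Continuous fun w : Vars n × Params n => pLine w.1 := by unfold pLine; fun_prop
  have hq : Continuous fun w : Vars n × Params n => qLine w.1 := by unfold qLine; fun_prop
  have hc : Continuous fun w : Vars n × Params n => cur w.1 := by unfold cur; fun_prop
  unfold redJac
  fun_prop

theorem redJac_flat : G.redJac (flat n).1 (flat n).2 = 1 := by
  have hp : pLine (flat n).1 = 0 := rfl
  have hq : qLine (flat n).1 = 0 := rfl
  have hc : cur (flat n).1 = 0 := rfl
  have hv : G.Aoutᵀ *ᵥ volt (flat n).1 (flat n).2 = 1 := by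
    ext e
    rw [Aout_transpose_mulVec_apply]
    refine Fin.cases ?_ (fun j => ?_) (G.parent e) <;> simp [volt, flat]
  simp [redJac, hp, hq, hc, hv]

variable {G}

theorem isMMatrix_redJac {u : Vars n} {ξ : Params n} (hw : (u, ξ) ∈ G.stabilityRegion) :
    IsMMatrix (G.redJac u ξ) := by
  have hregion : ∀ w ∈ G.stabilityRegion, w ∈ G.operatingPoints ∧ (G.jac w.1 w.2).det ≠ 0 :=
    connectedComponentIn_subset _ _
  have hflat : flat n ∈ G.stabilityRegion :=
    mem_connectedComponentIn (connectedComponentIn_nonempty_iff.mp ⟨(u, ξ), hw⟩)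
  have : PreconnectedSpace G.stabilityRegion :=
    isPreconnected_iff_preconnectedSpace.mp isPreconnected_connectedComponentIn
  exact IsMMatrix.of_preconnectedSpace (M := fun w : G.stabilityRegion => G.redJac w.1.1 w.1.2)
    (a₀ := ⟨flat n, hflat⟩) (G.continuous_redJac.comp continuous_subtype_val)
    (fun w _ _ hij => redJac_off_diag_nonpos (hregion w w.2).1 hij)
    (fun w => det_redJac_ne_zero (hregion w w.2).2)
    (G.redJac_flat ▸ IsMMatrix.one) ⟨(u, ξ), hw⟩

end StabilityRegion

end Network

end RadialGrid

theorem mainTheorem5_general (n : ℕ) (hn : 1 ≤ n) (G : RadialGrid.Network n)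
    (u : RadialGrid.Vars n) (ξ : RadialGrid.Params n) (hw : (u, ξ) ∈ G.stabilityRegion) :
    0 < (G.redJac u ξ).det ∧ (∀ e, 0 < G.redJac u ξ e e) ∧ G.rho u ξ < 1 ∧
      G.VSI u ξ ≤ G.VSIA u ξ ∧
      G.VSIA u ξ ≤ G.VSI u ξ - G.rho u ξ * Real.log (1 - G.rho u ξ) := by
  have hM : IsMMatrix (G.redJac u ξ) := RadialGrid.Network.isMMatrix_redJac hw
  have hn₀ : (0 : ℝ) < n := Nat.cast_pos.mpr hn
  refine ⟨hM.det_pos, hM.diag_pos, hM.specRad_jacobiMatrix_lt_one, ?_, ?_⟩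
  · exact div_le_div_of_nonneg_right hM.log_det_le_log_prod_diag hn₀.le
  · rw [RadialGrid.Network.VSIA, RadialGrid.Network.VSI, div_le_iff₀ hn₀, sub_mul,
      div_mul_cancel₀ _ hn₀.ne', mul_comm _ (n : ℝ)]
    exact hM.log_prod_diag_le

theorem mainTheorem5 (n : ℕ) (hn : 1 ≤ n) (G : RadialGrid.Network n)
    (u : RadialGrid.Vars n) (ξ : RadialGrid.Params n)
    (hw : (u, ξ) ∈ G.stabilityRegion)
    (hp : ∀ e : Fin n, 0 < RadialGrid.pBus u ξ e.succ)
    (hq : ∀ e : Fin n, 0 < RadialGrid.qBus u ξ e.succ) :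
    0 < (G.redJac u ξ).det ∧ (∀ e, 0 < G.redJac u ξ e e) ∧ G.rho u ξ < 1 ∧
      G.VSI u ξ ≤ G.VSIA u ξ ∧
      G.VSIA u ξ ≤ G.VSI u ξ - G.rho u ξ * Real.log (1 - G.rho u ξ) :=
  mainTheorem5_general n hn G u ξ hw
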